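/- **Monotone bandits.** There are finitely many arms. Arm $i$ has a finite non-empty state space $\mathcal S_i$, rewards $r^i_k\ge 0$, escape probabilities $f^i_k(t)\in[0,1]$ ($t=1,2,\dots$) nondecreasing in $t$, and numbers $q^i(k,j)\ge 0$ with $\sum_{j\ne k}q^i(k,j)\le 1$. Each $f^i_k$ is piecewise linear: there is a finite set $\mathcal W^i_k\ni 1$ of breakpoints such that $f^i_k$ is linear between consecutive breakpoints and constant from the last one on. For each $i$ the directed graph on $\mathcal S_i$ with edges $(j,k)$, $q^i(j,k)>0$, is strongly connected. In each step at most one arm is played; an arm that is not played keeps its state and yields nothing. If arm $i$ is in state $k$ and is played $t\ge1$ steps after it was last played (after the start, if it was never played; $t=1$ in the first step), it yields $r^i_k$, moves to $j\neq k$ with probability $f^i_k(t)q^i(k,j)$, and otherwise stays in $k$. A policy may be randomized and depend on the whole history, and start states may be chosen. $R_T$ is the total reward of the first $T$ steps. Let $OPT$ be the optimal value of Whittle's linear program: maximize $\sum_{i,k,t\ge1}r^i_kx^i_{kt}$ over $x\ge0$ subject to $\sum_{i,k,t}x^i_{kt}\le1$; $\sum_{k,t}t\,x^i_{kt}\le1$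 for all $i$; and $\sum_{j\ne k}\sum_t x^i_{kt}q^i(k,j)f^i_k(t)=\sum_{j\ne k}\sum_t x^i_{jt}q^i(j,k)f^i_j(t)$ for all $i,k$. Put $\Delta P^i_k=\sum_{j\ne k}q^i(k,j)(p^i_j-p^i_k)$. The balanced dual LP (Balance) is: minimize $\lambda+\sum_ih_i$ over $\lambda,h_i\ge0$ and $p^i_k\in\mathbb R$ subject to $\lambda=\sum_ih_i$ and $$\lambda+t\,h_i\ \ge\ r^i_k+f^i_k(t)\,\Delta P^i_k\qquad\text{for all } i,\ k\in\mathcal S_i,\ t\in\mathcal W^i_k.$$ **BalancedIndex policy** for an optimal solution $(\lambda,h,p)$ of (Balance). Only arms with $h_i>0$ are played. (a) Suppose that for every such arm $i$ and every $k\in\mathcal S_i$ the above constraint is tight for some $t\in\mathcal W^i_k$; let $t^i_k$ be the smallest such $t$. Call $k$ good if $\Delta P^i_k<0$; call arm $i$ ready if its state $k$ is not good and it has been there, since its last play, for at least $t^i_k$ steps. From any start states: if the arm played in the previous step is now in a good state, play it again; otherwise, if some arm is in a good state, play such an arm; otherwise play any ready arm; if there is none, do not play. (b) Otherwise, choose an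 arm $i$ with $h_i>0$ and a state $j\in\mathcal S_i$ with $f^i_j(1)=0$ and $r^i_j=\lambda+h_i$, start arm $i$ in $j$, and play it in every step. **Theorem.** (Balance) has an optimal solution. For every optimal solution a BalancedIndex policy exists (in particular, the choice in (b) is possible when it is needed), and every BalancedIndex policy, however ties are broken, satisfies $$\liminf_{T\to\infty}\frac{\mathbb E[R_T]}{T}\ \ge\ \frac{OPT}{2},$$ and is a $2$-approximation: for every policy $\pi'$ and all start states, $\limsup_{T\to\infty}\mathbb E_{\pi'}[R_T]/T\le 2\liminf_{T\to\infty}\mathbb E[R_T]/T$. -/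

import Mathlib

open Filter

noncomputable section

/-- A Monotone bandit with (finite) set of arms `ι` and state spaces `S i`.  Times are positive
integers.  The values `q i k k` on the diagonal are never used. -/
structure MonotoneBandit (ι : Type*) (S : ι → Type*) [Fintype ι] [DecidableEq ι]
    [∀ i, Fintype (S i)] [∀ i, DecidableEq (S i)] where
  /-- reward `r^i_k` for playing arm `i` in state `k` -/
  r : ∀ i, S i → ℝ
  /-- escape probability `f^i_k(t)` -/
  f : ∀ i, S i → ℕ+ → ℝ
  /-- distribution `q^i(k, j)` of the new state, given an escape -/
  q : ∀ i, S i → S i → ℝ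
  /-- breakpoints of the piecewise linear function `f^i_k` -/
  W : ∀ i, S i → Finset ℕ+
  r_nonneg : ∀ i k, 0 ≤ r i k
  f_nonneg : ∀ i k t, 0 ≤ f i k t
  f_le_one : ∀ i k t, f i k t ≤ 1
  q_nonneg : ∀ i k j, 0 ≤ q i k j
  q_sum_le_one : ∀ i k, ∑ j ∈ Finset.univ.erase k, q i k j ≤ 1
  /-- the Monotone property -/
  f_mono : ∀ i k t, f i k t ≤ f i k (t + 1)
  one_mem_W : ∀ i k, 1 ∈ W i k
  /-- linear interpolation between consecutive breakpoints -/
  f_interp : ∀ i k, ∀ t₁ ∈ W i k, ∀ t₂ ∈ W i k, t₁ < t₂ →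
    (∀ u ∈ W i k, u ≤ t₁ ∨ t₂ ≤ u) → ∀ t : ℕ+, t₁ < t → t < t₂ →
      f i k t = (((t₂ : ℝ) - (t : ℝ)) * f i k t₁ + ((t : ℝ) - (t₁ : ℝ)) * f i k t₂)
        / ((t₂ : ℝ) - (t₁ : ℝ))
  /-- constant from the last breakpoint on -/
  f_tail : ∀ i k, ∀ t₁ ∈ W i k, (∀ u ∈ W i k, u ≤ t₁) → ∀ t : ℕ+, t₁ ≤ t →
      f i k t = f i k t₁
  /-- for each arm the graph with edges `q i a b > 0` is strongly connected -/
  connected : ∀ i (j k : S i), Relation.ReflTransGen (fun a b => 0 < q i a b) j k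

/-- A triple `(λ, h, p)` of dual variables. -/
structure BalanceVars (ι : Type*) (S : ι → Type*) where
  lam : ℝ
  h : ι → ℝ
  p : ∀ i, S i → ℝ

namespace MonotoneBandit

variable {ι : Type*} {S : ι → Type*} [Fintype ι] [DecidableEq ι]
  [∀ i, Fintype (S i)] [∀ i, DecidableEq (S i)]

/-! ### The controlled stochastic process -/

/-- Joint configuration: for each arm its state and the number `y ≥ 1` of steps since it was last
played (or since the start): an arm that is played now is played after `y` steps. -/
abbrev Config (S : ι → Type*) : Type _ := ∀ i, S i × ℕ+

/-- The past of the process: configurations and actions, most recent first.  The action `none`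
means that no arm is played. -/
abbrev History (S : ι → Type*) : Type _ := List (Config S × Option ι)

/-- A (history dependent, randomized) policy; it plays at most one arm in each step. -/
abbrev Policy (S : ι → Type*) : Type _ := History S → Config S → PMF (Option ι)

/-- The initial configuration with chosen start states. -/
def start (s : ∀ i, S i) : Config S := fun i => (s i, 1)

/-- Probability to move from `k` to `j` when arm `i` is played in state `k` after `t` steps. -/
def transProb (B : MonotoneBandit ι S) (i : ι) (k : S i) (t : ℕ+) (j : S i) : ℝ :=
  if j = k then 1 - ∑ l ∈ Finset.univ.erase k, B.f i k t * B.q i k l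
  else B.f i k t * B.q i k j

theorem transProb_nonneg (B : MonotoneBandit ι S) (i : ι) (k : S i) (t : ℕ+) (j : S i) :
    0 ≤ B.transProb i k t j := by
  unfold transProb
  split_ifs
  · rw [← Finset.mul_sum]
    have h1 := B.q_sum_le_one i k
    have h2 := B.f_le_one i k t
    have h3 := B.f_nonneg i k t
    have h4 : 0 ≤ ∑ l ∈ Finset.univ.erase k, B.q i k l :=
      Finset.sum_nonneg fun l _ => B.q_nonneg i k l
    nlinarith
  · exact mul_nonneg (B.f_nonneg i k t) (B.q_nonneg i k j)

theorem transProb_sum (B : MonotoneBandit ι S) (i : ι) (k : S i) (t : ℕ+) :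
    ∑ j, B.transProb i k t j = 1 := by
  rw [← Finset.add_sum_erase _ _ (Finset.mem_univ k)]
  have h : ∑ j ∈ Finset.univ.erase k, B.transProb i k t j
      = ∑ l ∈ Finset.univ.erase k, B.f i k t * B.q i k l :=
    Finset.sum_congr rfl fun j hj => by simp [transProb, Finset.ne_of_mem_erase hj]
  rw [h]
  simp [transProb]

/-- Law of the new state of arm `i` when it is played in state `k` after `t` steps. -/
def nextState (B : MonotoneBandit ι S) (i : ι) (k : S i) (t : ℕ+) : PMF (S i) :=
  PMF.ofFintype (fun j => ENNReal.ofReal (B.transProb i k t j)) (by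
    rw [← ENNReal.ofReal_sum_of_nonneg fun j _ => B.transProb_nonneg i k t j, B.transProb_sum,
      ENNReal.ofReal_one])

/-- All arms wait for one step. -/
def wait (c : Config S) : Config S := fun l => ((c l).1, (c l).2 + 1)

/-- Law of the next configuration: the played arm moves and its clock restarts at `1`; all other
arms keep their state and their clocks advance. -/
def step (B : MonotoneBandit ι S) (c : Config S) : Option ι → PMF (Config S)
  | none => PMF.pure (wait c)
  | some i => (B.nextState i (c i).1 (c i).2).map fun j => Function.update (wait c) i (j, 1)

/-- Reward of an action. -/
def reward (B : MonotoneBandit ι S) (c : Config S) : Option ι → ℝ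
  | none => 0
  | some i => B.r i (c i).1

/-- Law of (past, current configuration) after `T` steps of policy `π` started at `c₀`. -/
def law (B : MonotoneBandit ι S) (π : Policy S) (c₀ : Config S) :
    ℕ → PMF (History S × Config S)
  | 0 => PMF.pure ([], c₀)
  | T + 1 => (law B π c₀ T).bind fun ω => (π ω.1 ω.2).bind fun a =>
      (B.step ω.2 a).map fun c' => ((ω.2, a) :: ω.1, c')

/-- Expected reward of the step that follows the first `T` steps. -/
def expStepReward (B : MonotoneBandit ι S) (π : Policy S) (c₀ : Config S) (T : ℕ) : ℝ :=
  ∑' ω, (B.law π c₀ T ω).toReal * ∑ a, (π ω.1 ω.2 a).toReal * B.reward ω.2 a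

/-- Expected time-average reward `E[R_T] / T` of the first `T` steps, for start states `s`. -/
def avgReward (B : MonotoneBandit ι S) (π : Policy S) (s : ∀ i, S i) (T : ℕ) : ℝ :=
  (∑ u ∈ Finset.range T, B.expStepReward π (start s) u) / T

/-! ### Whittle's linear program -/

/-- Feasibility for Whittle's (infinite) linear program. -/
structure WhittleFeasible (B : MonotoneBandit ι S) (x : ∀ i, S i → ℕ+ → ℝ) : Prop where
  nonneg : ∀ i k t, 0 ≤ x i k t
  /-- The series in the constraint for arm `i` converge; all other series are then convergent. -/
  summable : ∀ i k, Summable fun t : ℕ+ => (t : ℝ) * x i k t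
  plays_le : ∑ i, ∑ k, ∑' t, x i k t ≤ 1
  time_le : ∀ i, ∑ k, ∑' t : ℕ+, (t : ℝ) * x i k t ≤ 1
  balance : ∀ i k,
    ∑ j ∈ Finset.univ.erase k, ∑' t, x i k t * B.q i k j * B.f i k t
      = ∑ j ∈ Finset.univ.erase k, ∑' t, x i j t * B.q i j k * B.f i j t

/-- The objective of Whittle's linear program. -/
def whittleObjective (B : MonotoneBandit ι S) (x : ∀ i, S i → ℕ+ → ℝ) : ℝ :=
  ∑ i, ∑ k, ∑' t, B.r i k * x i k t

/-- `OPT`, the optimal value of Whittle's linear program. -/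
def OPT (B : MonotoneBandit ι S) : ℝ :=
  sSup {v | ∃ x, B.WhittleFeasible x ∧ v = B.whittleObjective x}

/-- The supremum in `OPT` is over a non-empty set which is bounded above. -/
theorem OPT_isLUB (B : MonotoneBandit ι S) :
    IsLUB {v | ∃ x, B.WhittleFeasible x ∧ v = B.whittleObjective x} B.OPT := by
  apply isLUB_csSup
  · refine ⟨_, fun _ _ _ => 0, ⟨?_, ?_, ?_, ?_, ?_⟩, rfl⟩ <;> simp [summable_zero]
  · refine ⟨∑ i, ∑ k, B.r i k, ?_⟩
    rintro v ⟨x, hx, rfl⟩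
    have hle : ∀ i k (t : ℕ+), x i k t ≤ (t : ℝ) * x i k t := fun i k t => by
      have h1 : (1 : ℝ) ≤ (t : ℝ) := by exact_mod_cast t.pos
      nlinarith [hx.nonneg i k t]
    have hs : ∀ i k, Summable (x i k) := fun i k =>
      Summable.of_nonneg_of_le (hx.nonneg i k) (hle i k) (hx.summable i k)
    refine Finset.sum_le_sum fun i _ => Finset.sum_le_sum fun k _ => ?_
    rw [tsum_mul_left]
    have h0 : ∀ l, 0 ≤ ∑' t : ℕ+, (t : ℝ) * x i l t := fun l =>
      tsum_nonneg fun t => mul_nonneg (Nat.cast_nonneg _) (hx.nonneg i l t)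
    have h1 : ∑' t, x i k t ≤ 1 :=
      ((hs i k).tsum_le_tsum (hle i k) (hx.summable i k)).trans
        ((Finset.single_le_sum (f := fun l => ∑' t : ℕ+, (t : ℝ) * x i l t)
          (fun l _ => h0 l) (Finset.mem_univ k)).trans (hx.time_le i))
    exact mul_le_of_le_one_right (B.r_nonneg i k) h1

/-! ### The balanced linear program -/

/-- `ΔP^i_k`, the expected change of the dual potential on an escape from state `k`. -/
def deltaP (B : MonotoneBandit ι S) (D : BalanceVars ι S) (i : ι) (k : S i) : ℝ :=
  ∑ j ∈ Finset.univ.erase k, B.q i k j * (D.p i j - D.p i k)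

/-- Feasibility for (Balance). -/
structure BalanceFeasible (B : MonotoneBandit ι S) (D : BalanceVars ι S) : Prop where
  dual : ∀ i k, ∀ t ∈ B.W i k,
    B.r i k + B.f i k t * B.deltaP D i k ≤ D.lam + (t : ℝ) * D.h i
  balance : D.lam = ∑ i, D.h i
  lam_nonneg : 0 ≤ D.lam
  h_nonneg : ∀ i, 0 ≤ D.h i

/-- Optimality for (Balance): minimize `λ + ∑ i, h i`. -/
def BalanceOptimal (B : MonotoneBandit ι S) (D : BalanceVars ι S) : Prop :=
  B.BalanceFeasible D ∧
    ∀ D', B.BalanceFeasible D' → D.lam + ∑ i, D.h i ≤ D'.lam + ∑ i, D'.h i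

/-! ### The BalancedIndex policy -/

/-- The times in `W i k` at which the constraint of (Balance) is tight. -/
def tightTimes (B : MonotoneBandit ι S) (D : BalanceVars ι S) (i : ι) (k : S i) : Set ℕ+ :=
  {t | t ∈ B.W i k ∧ D.lam + (t : ℝ) * D.h i = B.r i k + B.f i k t * B.deltaP D i k}

/-- For every arm with `h i > 0`, every state has a tight constraint. -/
def AllTight (B : MonotoneBandit ι S) (D : BalanceVars ι S) : Prop :=
  ∀ i, 0 < D.h i → ∀ k, (B.tightTimes D i k).Nonempty

/-- Arm `i` is retained (`h i > 0`) and its current state is good, that is, in `G_i`. -/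
def Good (B : MonotoneBandit ι S) (D : BalanceVars ι S) (c : Config S) (i : ι) : Prop :=
  0 < D.h i ∧ B.deltaP D i (c i).1 < 0

/-- Arm `i` is retained, its current state `k` is in `I_i`, and it has waited for at least
`t^i_k` steps, where `t^i_k` is the smallest tight time. -/
def Ready (B : MonotoneBandit ι S) (D : BalanceVars ι S) (c : Config S) (i : ι) : Prop :=
  0 < D.h i ∧ 0 ≤ B.deltaP D i (c i).1 ∧
    ∃ t, IsLeast (B.tightTimes D i (c i).1) t ∧ t ≤ (c i).2

/-- The action of the most recent step (`none` at the start). -/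
def lastAction : History S → Option ι
  | [] => none
  | (_, a) :: _ => a

/-- The actions that the index rule allows in configuration `c` with past `past`: keep playing the
current arm while it is good; otherwise play a good arm, if there is one (only an arm that is in
its start state can be of this kind); otherwise play any ready arm; otherwise idle. -/
def IndexAction (B : MonotoneBandit ι S) (D : BalanceVars ι S) (past : History S) (c : Config S)
    (a : Option ι) : Prop :=
  (∃ i, lastAction past = some i ∧ B.Good D c i ∧ a = some i) ∨
  ((¬ ∃ i, lastAction past = some i ∧ B.Good D c i) ∧ ∃ i, B.Good D c i ∧ a = some i) ∨
  ((¬ ∃ i, B.Good D c i) ∧ ∃ i, B.Ready D c i ∧ a = some i) ∨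
  ((¬ ∃ i, B.Good D c i) ∧ (¬ ∃ i, B.Ready D c i) ∧ a = none)

/-- `π`, with start states `s`, is a BalancedIndex policy built from `D` (ties are broken in any
way).  If all retained arms have tight constraints in all states, it follows the index rule, from
any start states.  Otherwise it is the trivial policy that always plays one arm, started in a state
`j` which is never left and whose reward is `λ + h i`. -/
def IsBalancedIndex (B : MonotoneBandit ι S) (D : BalanceVars ι S) (s : ∀ i, S i)
    (π : Policy S) : Prop :=
  (B.AllTight D ∧ ∀ past c, ∀ a ∈ (π past c).support, B.IndexAction D past c a) ∨
  (¬ B.AllTight D ∧ ∃ i, 0 < D.h i ∧ B.f i (s i) 1 = 0 ∧ B.r i (s i) = D.lam + D.h i ∧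
    ∀ past c, π past c = PMF.pure (some i))

end MonotoneBandit

end

/-!
Both bounds compare the reward with the drift of a potential. Feasible dual variables `(λ, h, p)`
give the potential `∑ l, p l k_l + h l * y_l`, where `k_l` is the state of arm `l` and `y_l` its
clock: by the dual constraints, the reward plus the expected change of this potential is at most
`λ + ∑ l, h l` in each step of every policy. Weak duality gives `OPT ≤ λ + ∑ l, h l` as well, and
balance turns this bound into `2 * λ`.

If the index rule applies, then each of its steps earns at least `λ` in this sense, for a potential
in which arm `l` stops accruing `h l` at its smallest tight time. If some arm is ready, its tight
constraint pays for `λ`; if no arm can be played, every retained arm is still accruing, and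
`λ = ∑ l, h l`; an arm in a good state has smallest tight time `1` and is played in consecutive
steps. It may be found in a good state with a larger clock only if it was not just played, which a
large penalty in the potential compensates for.

If a state `k` of a retained arm `i` has no tight constraint, strong connectivity provides a
function whose expected change on an escape is negative in all states but `k`. Adding a small
multiple of it to `p i` makes all tight constraints of the arm with a positive escape probability
slack; if all constraints of the arm become slack, `λ` can be lowered. So an optimal solution has a
tight constraint of arm `i` with escape probability `0`. By monotonicity the escape probability at
time `1` is `0` too, and comparing the two constraints gives the reward `λ + h i` of case (b).
-/

section LinearProgramming

variable {𝕜 E J : Type*} [Field 𝕜] [AddCommGroup E] [Module 𝕜 E]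
  {a : J → E →ₗ[𝕜] 𝕜} {b : J → 𝕜} {c : E →ₗ[𝕜] 𝕜} {x d : E}

/-- The constraints that hold with equality at `x`. -/
def tightSet (a : J → E →ₗ[𝕜] 𝕜) (b : J → 𝕜) (x : E) : Set J := {j | a j x = b j}

/-- The tight constraints at `x` determine the objective `c`.  This plays the role of being a
vertex, of which a polyhedron that contains a line has none. -/
def IsBasic (a : J → E →ₗ[𝕜] 𝕜) (b : J → 𝕜) (c : E →ₗ[𝕜] 𝕜) (x : E) : Prop :=
  ∀ d, (∀ j ∈ tightSet a b x, a j d = 0) → c d = 0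

theorem IsBasic.map_eq_of_tightSet_eq {y : E} (hx : IsBasic a b c x)
    (h : tightSet a b x = tightSet a b y) : c x = c y := by
  rw [← sub_eq_zero, ← map_sub]
  refine hx _ fun j hj => ?_
  have hxj : a j x = b j := hj
  have hyj : a j y = b j := h.subset hj
  rw [map_sub, hxj, hyj, sub_self]

variable [LinearOrder 𝕜]

/-- The feasible region of the linear inequalities `b j ≤ a j x`. -/
def polyhedron (a : J → E →ₗ[𝕜] 𝕜) (b : J → 𝕜) : Set E := {x | ∀ j, b j ≤ a j x}

variable [IsStrictOrderedRing 𝕜]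

theorem nonneg_of_mem_recession (hc : BddBelow (c '' polyhedron a b)) (hx : x ∈ polyhedron a b)
    (hd : ∀ j, 0 ≤ a j d) : 0 ≤ c d := by
  by_contra! hcd
  obtain ⟨m, hm⟩ := hc
  have hray : ∀ s : 𝕜, 0 ≤ s → m ≤ c x + s * c d := fun s hs => by
    have hmem : x + s • d ∈ polyhedron a b := fun j => by
      simpa using le_add_of_le_of_nonneg (hx j) (mul_nonneg hs (hd j))
    simpa using hm (Set.mem_image_of_mem c hmem)
  have hmx : m ≤ c x := by simpa using hray 0 le_rfl
  have h := hray ((c x - m + 1) / -c d) (div_nonneg (by linarith) (by linarith))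
  rw [div_neg, neg_mul, div_mul_cancel₀ _ hcd.ne] at h
  linarith

/-- The ratio test of the simplex method. -/
theorem exists_add_smul_tight [Finite J] (hx : x ∈ polyhedron a b) (hd : ∃ j, a j d < 0) :
    ∃ s : 𝕜, 0 ≤ s ∧ x + s • d ∈ polyhedron a b ∧
      ∃ j ∈ tightSet a b (x + s • d), a j d < 0 := by
  obtain ⟨j₀, hj₀, hmin⟩ := Set.exists_min_image {j | a j d < 0}
    (fun j => (a j x - b j) / -a j d) (Set.toFinite _) hd
  have hneg : a j₀ d < 0 := hj₀
  have hs : 0 ≤ (a j₀ x - b j₀) / -a j₀ d :=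
    div_nonneg (sub_nonneg.2 (hx j₀)) (neg_nonneg.2 hneg.le)
  refine ⟨_, hs, fun j => ?_, j₀, ?_, hj₀⟩
  · rw [map_add, map_smul, smul_eq_mul]
    rcases lt_or_ge (a j d) 0 with hj | hj
    · have h := hmin j hj
      rw [le_div_iff₀ (neg_pos.2 hj)] at h
      linarith
    · exact le_add_of_le_of_nonneg (hx j) (mul_nonneg hs hj)
  · change a j₀ (x + _ • d) = b j₀
    rw [map_add, map_smul, smul_eq_mul, div_neg, neg_mul, div_mul_cancel₀ _ hneg.ne]
    ring

theorem exists_tightSet_ssubset [Finite J] (hc : BddBelow (c '' polyhedron a b))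
    (hx : x ∈ polyhedron a b) (hbasic : ¬ IsBasic a b c x) :
    ∃ y ∈ polyhedron a b, c y ≤ c x ∧ tightSet a b x ⊂ tightSet a b y := by
  obtain ⟨d, hd, hcd⟩ : ∃ d, (∀ j ∈ tightSet a b x, a j d = 0) ∧ c d < 0 := by
    simp only [IsBasic, not_forall] at hbasic
    obtain ⟨d, hd, hcd⟩ := hbasic
    rcases lt_or_gt_of_ne hcd with hcd | hcd
    · exact ⟨d, hd, hcd⟩
    · exact ⟨-d, fun j hj => by rw [map_neg, hd j hj, neg_zero], by rwa [map_neg, neg_lt_zero]⟩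
  have hdesc : ∃ j, a j d < 0 := by
    by_contra! h
    exact (nonneg_of_mem_recession hc hx h).not_gt hcd
  obtain ⟨s, hs, hy, j, hjy, hj⟩ := exists_add_smul_tight hx hdesc
  refine ⟨x + s • d, hy, ?_, (Set.ssubset_iff_of_subset fun l hl => ?_).2
    ⟨j, hjy, fun hjx => hj.ne (hd j hjx)⟩⟩
  · rw [map_add, map_smul, smul_eq_mul]
    exact add_le_of_nonpos_right (mul_nonpos_of_nonneg_of_nonpos hs hcd.le)
  · change a l (x + s • d) = b l
    rw [map_add, map_smul, hd l hl, smul_zero, add_zero]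
    exact hl

theorem exists_isBasic_le [Finite J] (hc : BddBelow (c '' polyhedron a b))
    (hx : x ∈ polyhedron a b) : ∃ y ∈ polyhedron a b, IsBasic a b c y ∧ c y ≤ c x := by
  obtain ⟨y, ⟨hy, hyx⟩, hmax⟩ := Set.Finite.exists_maximalFor' (tightSet a b)
    {y | y ∈ polyhedron a b ∧ c y ≤ c x} (Set.toFinite _) ⟨x, hx, le_rfl⟩
  refine ⟨y, hy, by_contra fun hbasic => ?_, hyx⟩
  obtain ⟨z, hz, hzy, hss⟩ := exists_tightSet_ssubset hc hy hbasic
  exact hss.not_subset (hmax ⟨hz, hzy.trans hyx⟩ hss.subset)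

theorem exists_isMinOn_polyhedron [Finite J] (hc : BddBelow (c '' polyhedron a b))
    (hne : (polyhedron a b).Nonempty) : ∃ x ∈ polyhedron a b, IsMinOn c (polyhedron a b) x := by
  let V : Set E := {y | y ∈ polyhedron a b ∧ IsBasic a b c y}
  have hfactor : Function.FactorsThrough (fun y : V => c y) fun y : V => tightSet a b (y : E) :=
    fun y _ h => y.2.2.map_eq_of_tightSet_eq h
  obtain ⟨e, he⟩ := (Function.factorsThrough_iff _).1 hfactor
  have hfin : (c '' V).Finite := (Set.finite_range e).subset <| by
    rintro _ ⟨y, hy, rfl⟩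
    exact ⟨_, (congrFun he ⟨y, hy⟩).symm⟩
  obtain ⟨x₀, hx₀⟩ := hne
  obtain ⟨y₀, hy₀, hbasic₀, -⟩ := exists_isBasic_le hc hx₀
  obtain ⟨y, ⟨hy, -⟩, hmin⟩ := Set.Finite.exists_minimalFor' c V hfin ⟨y₀, hy₀, hbasic₀⟩
  refine ⟨y, hy, fun z hz => ?_⟩
  obtain ⟨w, hw, hwbasic, hwz⟩ := exists_isBasic_le hc hz
  exact (le_of_not_gt fun hlt => (hmin ⟨hw, hwbasic⟩ hlt.le).not_gt hlt).trans hwz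

end LinearProgramming

section Expectation

variable {α β : Type*} {p : PMF α} {g g' : α → ℝ} {κ : ℝ}

/-- Expectation of a real function under a discrete law.  It is used for laws of finite support
only, for which there is no question of convergence. -/
noncomputable def expectation (p : PMF α) (g : α → ℝ) : ℝ := ∑' a, (p a).toReal * g a

theorem summable_toReal_mul (hp : p.support.Finite) (g : α → ℝ) :
    Summable fun a => (p a).toReal * g a :=
  summable_of_hasFiniteSupport <| hp.subset fun a ha h0 => ha (by simp [h0])

theorem expectation_const (p : PMF α) (κ : ℝ) : expectation p (fun _ => κ) = κ := by
  rw [expectation, tsum_mul_right, ← ENNReal.tsum_toReal_eq p.apply_ne_top, p.tsum_coe,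
    ENNReal.toReal_one, one_mul]

theorem expectation_add (hp : p.support.Finite) (g g' : α → ℝ) :
    expectation p (fun a => g a + g' a) = expectation p g + expectation p g' := by
  simp only [expectation, mul_add]
  exact (summable_toReal_mul hp g).tsum_add (summable_toReal_mul hp g')

theorem expectation_sub (hp : p.support.Finite) (g g' : α → ℝ) :
    expectation p (fun a => g a - g' a) = expectation p g - expectation p g' := by
  simp only [expectation, mul_sub]
  exact (summable_toReal_mul hp g).tsum_sub (summable_toReal_mul hp g')

theorem expectation_mono (hp : p.support.Finite) (h : ∀ a ∈ p.support, g a ≤ g' a) :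
    expectation p g ≤ expectation p g' := by
  refine (summable_toReal_mul hp g).tsum_le_tsum (fun a => ?_) (summable_toReal_mul hp g')
  by_cases ha : a ∈ p.support
  · exact mul_le_mul_of_nonneg_left (h a ha) ENNReal.toReal_nonneg
  · simp [(p.apply_eq_zero_iff a).2 ha]

theorem le_expectation (hp : p.support.Finite) (h : ∀ a ∈ p.support, κ ≤ g a) :
    κ ≤ expectation p g :=
  (expectation_const p κ).symm.trans_le (expectation_mono hp h)

theorem expectation_le (hp : p.support.Finite) (h : ∀ a ∈ p.support, g a ≤ κ) :
    expectation p g ≤ κ :=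
  (expectation_mono hp h).trans_eq (expectation_const p κ)

theorem expectation_pure (a : α) (g : α → ℝ) : expectation (PMF.pure a) g = g a := by
  rw [expectation, tsum_eq_single a fun b hb => by simp [PMF.pure_apply, hb]]
  simp

theorem finite_support_bind (hp : p.support.Finite) {q : α → PMF β}
    (hq : ∀ a, (q a).support.Finite) : (p.bind q).support.Finite := by
  rw [PMF.support_bind]
  exact hp.biUnion fun a _ => hq a

theorem finite_support_map (hp : p.support.Finite) (u : α → β) : (p.map u).support.Finite := by
  rw [PMF.support_map]
  exact hp.image u

theorem expectation_bind (hp : p.support.Finite) {q : α → PMF β}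
    (hq : ∀ a, (q a).support.Finite) (g : β → ℝ) :
    expectation (p.bind q) g = expectation p fun a => expectation (q a) g := by
  have hsum : ∀ f : α → ℝ, ∑' a, (p a).toReal * f a = ∑ a ∈ hp.toFinset, (p a).toReal * f a :=
    fun f => tsum_eq_sum fun a ha => by
      rw [Set.Finite.mem_toFinset, ← p.apply_eq_zero_iff] at ha
      rw [ha, ENNReal.toReal_zero, zero_mul]
  have hbind : ∀ b, (p.bind q b).toReal = ∑' a, (p a).toReal * (q a b).toReal := fun b => by
    rw [PMF.bind_apply, ENNReal.tsum_toReal_eq fun a =>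
      ENNReal.mul_ne_top (p.apply_ne_top a) ((q a).apply_ne_top b)]
    simp only [ENNReal.toReal_mul]
  simp only [expectation, hbind, hsum, Finset.sum_mul, mul_assoc]
  rw [Summable.tsum_finsetSum fun a _ => (summable_toReal_mul (hq a) g).mul_left _]
  simp only [tsum_mul_left]

theorem expectation_map (hp : p.support.Finite) (u : α → β) (g : β → ℝ) :
    expectation (p.map u) g = expectation p fun a => g (u a) := by
  rw [PMF.map, expectation_bind hp fun a => by simp]
  simp only [Function.comp_apply, expectation_pure]

end Expectation

theorem exists_rank_of_reflTransGen {α : Type*} {r : α → α → Prop} {k : α}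
    (h : ∀ j, Relation.ReflTransGen r j k) : ∃ d : α → ℕ, ∀ j ≠ k, ∃ l, r j l ∧ d l < d j := by
  let paths : α → Set (List α) := fun j =>
    {L | (j :: L).IsChain r ∧ (j :: L).getLast (List.cons_ne_nil j L) = k}
  refine ⟨fun j => sInf (List.length '' paths j), fun j hj => ?_⟩
  obtain ⟨L, ⟨hchain, hlast⟩, hlength⟩ : sInf (List.length '' paths j) ∈ List.length '' paths j :=
    Nat.sInf_mem (Set.Nonempty.image _ (List.exists_isChain_cons_of_relationReflTransGen (h j)))
  match L with
  | [] => exact absurd hlast hj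
  | l :: L =>
    refine ⟨l, (List.isChain_cons_cons.1 hchain).1, ?_⟩
    have hmem : L ∈ paths l := ⟨(List.isChain_cons_cons.1 hchain).2, by simpa using hlast⟩
    calc sInf (List.length '' paths l) ≤ L.length := Nat.sInf_le (Set.mem_image_of_mem _ hmem)
      _ < (l :: L).length := Nat.lt_succ_self _
      _ = _ := hlength

open scoped Topology in
theorem exists_pos_lt_of_finite {α : Type*} [Finite α] (a : α → ℝ) :
    ∃ ε, 0 < ε ∧ ε < 1 ∧ ∀ x, 0 < a x → ε < a x := by
  have hsmall : ∀ᶠ ε in 𝓝[>] (0 : ℝ), ∀ x, 0 < a x → ε < a x :=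
    eventually_all.2 fun x => eventually_imp_distrib_left.2 fun hx =>
      mem_nhdsWithin_of_mem_nhds (Iio_mem_nhds hx)
  obtain ⟨ε, hε, hpos, hlt⟩ := (hsmall.and (Ioo_mem_nhdsGT zero_lt_one)).exists
  exact ⟨ε, hpos, hlt, hε⟩

noncomputable section

namespace MonotoneBandit

open scoped Topology

variable {ι : Type*} {S : ι → Type*} [Fintype ι] [DecidableEq ι]
  [∀ i, Fintype (S i)] [∀ i, DecidableEq (S i)] {B : MonotoneBandit ι S} {D : BalanceVars ι S}
  {i : ι} {k : S i}

/-! ### The escape generator -/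

/-- The operator `L g k = ∑_{j ≠ k} q(k, j) (g j - g k)`: the expected change of `g` on an escape.
In the notation of the paper, `ΔP^i = L p^i`. -/
def generator (B : MonotoneBandit ι S) (i : ι) : (S i → ℝ) →ₗ[ℝ] (S i → ℝ) :=
  LinearMap.pi fun k => ∑ j ∈ Finset.univ.erase k,
    B.q i k j • ((LinearMap.proj j : (S i → ℝ) →ₗ[ℝ] ℝ) - LinearMap.proj k)

theorem generator_apply (B : MonotoneBandit ι S) (i : ι) (g : S i → ℝ) (k : S i) :
    B.generator i g k = ∑ j ∈ Finset.univ.erase k, B.q i k j * (g j - g k) := by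
  simp [generator]

theorem deltaP_eq_generator (B : MonotoneBandit ι S) (D : BalanceVars ι S) (i : ι) (k : S i) :
    B.deltaP D i k = B.generator i (D.p i) k :=
  (B.generator_apply i (D.p i) k).symm

theorem generator_add_const (B : MonotoneBandit ι S) (i : ι) (g : S i → ℝ) (κ : ℝ) :
    B.generator i (fun j => g j + κ) = B.generator i g := by
  ext k
  simp only [generator_apply, add_sub_add_right_eq_sub]

theorem sum_mul_generator_eq_zero {w : S i → ℝ}
    (hw : ∀ k, ∑ j ∈ Finset.univ.erase k, w k * B.q i k j
      = ∑ j ∈ Finset.univ.erase k, w j * B.q i j k) (g : S i → ℝ) :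
    ∑ k, w k * B.generator i g k = 0 := by
  have hterm : ∀ k, w k * B.generator i g k
      = ∑ j, w k * B.q i k j * g j - ∑ j, w k * B.q i k j * g k := fun k => by
    rw [generator_apply, Finset.mul_sum, ← Finset.sum_sub_distrib,
      ← Finset.sum_erase_add _ _ (Finset.mem_univ k), sub_self, add_zero]
    exact Finset.sum_congr rfl fun j _ => by ring
  have hflow : ∀ k, ∑ j, w k * B.q i k j = ∑ j, w j * B.q i j k := fun k => by
    rw [← Finset.sum_erase_add _ _ (Finset.mem_univ k), hw k,
      ← Finset.sum_erase_add Finset.univ (fun j => w j * B.q i j k) (Finset.mem_univ k)]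
  simp only [hterm, Finset.sum_sub_distrib]
  rw [Finset.sum_comm, sub_eq_zero]
  refine Finset.sum_congr rfl fun k _ => ?_
  rw [← Finset.sum_mul, ← Finset.sum_mul, hflow]

/-! ### Existence of an optimal solution of (Balance) -/

/-- The dual variables with free part `(h, p)`; the constraint `λ = ∑ i, h i` eliminates `λ`. -/
def balanceVars (x : (ι → ℝ) × (∀ i, S i → ℝ)) : BalanceVars ι S := ⟨∑ i, x.1 i, x.1, x.2⟩

/-- The linear forms in `(h, p)` of the inequalities of (Balance): the dual constraints at the
breakpoints, and `0 ≤ h i`. -/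
def balanceForm (B : MonotoneBandit ι S) :
    (Σ i, Σ k : S i, B.W i k) ⊕ ι → ((ι → ℝ) × (∀ i, S i → ℝ)) →ₗ[ℝ] ℝ :=
  Sum.elim
    (fun ⟨i, k, t⟩ =>
      (∑ l, LinearMap.proj l + ((t : ℕ+) : ℝ) • LinearMap.proj i) ∘ₗ LinearMap.fst ℝ _ _
        - B.f i k t • LinearMap.proj k ∘ₗ B.generator i ∘ₗ LinearMap.proj i ∘ₗ
          LinearMap.snd ℝ _ _)
    fun i => LinearMap.proj i ∘ₗ LinearMap.fst ℝ _ _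

/-- The right hand sides of the inequalities of (Balance). -/
def balanceBound (B : MonotoneBandit ι S) : (Σ i, Σ k : S i, B.W i k) ⊕ ι → ℝ :=
  Sum.elim (fun x => B.r x.1 x.2.1) fun _ => 0

theorem balanceVars_eq_of_feasible (hD : B.BalanceFeasible D) : balanceVars (D.h, D.p) = D := by
  obtain ⟨lam, h, p⟩ := D
  exact congrArg (BalanceVars.mk · h p) hD.balance.symm

theorem mem_polyhedron_balance_iff (x : (ι → ℝ) × (∀ i, S i → ℝ)) :
    x ∈ polyhedron B.balanceForm B.balanceBound ↔ B.BalanceFeasible (balanceVars x) := by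
  have hdual : ∀ i (k : S i) (t : B.W i k), B.balanceForm (Sum.inl ⟨i, k, t⟩) x
      = (balanceVars x).lam + ((t : ℕ+) : ℝ) * (balanceVars x).h i
        - B.f i k t * B.deltaP (balanceVars x) i k := fun i k t => by
    simp [balanceForm, balanceVars, deltaP_eq_generator]
  constructor
  · intro hx
    have hh : ∀ i, 0 ≤ x.1 i := fun i => hx (Sum.inr i)
    refine ⟨fun i k t ht => ?_, rfl, Finset.sum_nonneg fun i _ => hh i, hh⟩
    have h : B.r i k ≤ B.balanceForm (Sum.inl ⟨i, k, t, ht⟩) x := hx (Sum.inl ⟨i, k, t, ht⟩)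
    rw [hdual] at h
    linarith
  · rintro hD (⟨i, k, t⟩ | i)
    · change B.r i k ≤ B.balanceForm (Sum.inl ⟨i, k, t⟩) x
      rw [hdual]
      linarith [hD.dual i k t t.2]
    · exact hD.h_nonneg i

theorem exists_balanceFeasible (B : MonotoneBandit ι S) : ∃ D, B.BalanceFeasible D := by
  have hr : ∀ i, 0 ≤ ∑ k, B.r i k := fun i => Finset.sum_nonneg fun k _ => B.r_nonneg i k
  have hlam : 0 ≤ ∑ i, ∑ k, B.r i k := Finset.sum_nonneg fun i _ => hr i
  refine ⟨⟨_, fun i => ∑ k, B.r i k, fun _ _ => 0⟩, fun i k t _ => ?_, rfl, hlam, hr⟩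
  calc B.r i k + B.f i k t * B.deltaP ⟨_, _, fun _ _ => 0⟩ i k
      = B.r i k := by simp [deltaP]
    _ ≤ ∑ k, B.r i k := Finset.single_le_sum (fun k _ => B.r_nonneg i k) (Finset.mem_univ k)
    _ ≤ t * ∑ k, B.r i k := le_mul_of_one_le_left (hr i) (by exact_mod_cast t.pos)
    _ ≤ _ := le_add_of_nonneg_left hlam

theorem exists_balanceOptimal (B : MonotoneBandit ι S) :
    ∃ D : BalanceVars ι S, B.BalanceOptimal D := by
  let lamForm : ((ι → ℝ) × (∀ i, S i → ℝ)) →ₗ[ℝ] ℝ :=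
    (∑ i, LinearMap.proj i) ∘ₗ LinearMap.fst ℝ _ _
  have hlamForm : ∀ x, lamForm x = (balanceVars x).lam := fun x => by
    simp [lamForm, balanceVars]
  have hbdd : BddBelow (lamForm '' polyhedron B.balanceForm B.balanceBound) :=
    ⟨0, Set.forall_mem_image.2 fun x hx =>
      hlamForm x ▸ ((mem_polyhedron_balance_iff x).1 hx).lam_nonneg⟩
  have hmem : ∀ {D}, B.BalanceFeasible D →
      (D.h, D.p) ∈ polyhedron B.balanceForm B.balanceBound := fun hD =>
    (mem_polyhedron_balance_iff _).2 ((balanceVars_eq_of_feasible hD).symm ▸ hD)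
  obtain ⟨D₀, hD₀⟩ := B.exists_balanceFeasible
  obtain ⟨x, hx, hmin⟩ := exists_isMinOn_polyhedron hbdd ⟨_, hmem hD₀⟩
  have hfeas := (mem_polyhedron_balance_iff x).1 hx
  refine ⟨balanceVars x, hfeas, fun D hD => ?_⟩
  have hle : lamForm x ≤ lamForm (D.h, D.p) := hmin (hmem hD)
  rw [hlamForm, hlamForm, balanceVars_eq_of_feasible hD] at hle
  rw [← hfeas.balance, ← hD.balance]
  exact add_le_add hle hle

/-! ### Weak duality -/

theorem f_monotone (B : MonotoneBandit ι S) (i : ι) (k : S i) : Monotone (B.f i k) :=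
  monotone_of_le_add_one fun t _ => B.f_mono i k t

theorem mul_f_le_of_forall_mem_W {α β γ : ℝ} (hβ : 0 ≤ β)
    (hW : ∀ t ∈ B.W i k, γ * B.f i k t ≤ α + (t : ℝ) * β) (t : ℕ+) :
    γ * B.f i k t ≤ α + (t : ℝ) * β := by
  obtain ⟨t₁, ht₁, hmax⟩ := ((B.W i k).filter (· ≤ t)).exists_max_image id
    ⟨1, Finset.mem_filter.2 ⟨B.one_mem_W i k, one_le⟩⟩
  obtain ⟨hW₁, hle₁⟩ := Finset.mem_filter.1 ht₁
  have hcast₁ : (t₁ : ℝ) ≤ t := by exact_mod_cast hle₁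
  by_cases hne : ((B.W i k).filter (t < ·)).Nonempty
  · obtain ⟨t₂, ht₂, hmin⟩ := Finset.exists_min_image _ id hne
    obtain ⟨hW₂, hlt₂⟩ := Finset.mem_filter.1 ht₂
    rcases hle₁.eq_or_lt with rfl | hlt₁
    · exact hW t₁ hW₁
    have hgap : ∀ u ∈ B.W i k, u ≤ t₁ ∨ t₂ ≤ u := fun u hu =>
      (le_or_gt u t).imp (fun h => hmax u (Finset.mem_filter.2 ⟨hu, h⟩))
        fun h => hmin u (Finset.mem_filter.2 ⟨hu, h⟩)
    have hcast₂ : (t : ℝ) < t₂ := by exact_mod_cast hlt₂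
    rw [B.f_interp i k t₁ hW₁ t₂ hW₂ (hlt₁.trans hlt₂) hgap t hlt₁ hlt₂, ← mul_div_assoc,
      div_le_iff₀ (by linarith)]
    have h₁ := mul_le_mul_of_nonneg_left (hW t₁ hW₁) (sub_nonneg.2 hcast₂.le)
    have h₂ := mul_le_mul_of_nonneg_left (hW t₂ hW₂) (sub_nonneg.2 hcast₁)
    linarith
  · have hlast : ∀ u ∈ B.W i k, u ≤ t₁ := fun u hu =>
      hmax u (Finset.mem_filter.2 ⟨hu, not_lt.1 fun h => hne ⟨u, Finset.mem_filter.2 ⟨hu, h⟩⟩⟩)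
    rw [B.f_tail i k t₁ hW₁ hlast t hle₁]
    linarith [hW t₁ hW₁, mul_le_mul_of_nonneg_right hcast₁ hβ]

theorem BalanceFeasible.dual_all (hD : B.BalanceFeasible D) (i : ι) (k : S i) (t : ℕ+) :
    B.r i k + B.f i k t * B.deltaP D i k ≤ D.lam + (t : ℝ) * D.h i := by
  have h := mul_f_le_of_forall_mem_W (α := D.lam - B.r i k) (γ := B.deltaP D i k)
    (hD.h_nonneg i) (fun t ht => by linarith [hD.dual i k t ht]) t
  linarith

/-- The rate `∑_t x_{kt} f_k(t)` of escape attempts from state `k` under the solution `x` of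
Whittle's linear program. -/
def escapeRate (B : MonotoneBandit ι S) (x : ∀ i, S i → ℕ+ → ℝ) (i : ι) (k : S i) : ℝ :=
  ∑' t, x i k t * B.f i k t

namespace WhittleFeasible

variable {x : ∀ i, S i → ℕ+ → ℝ}

theorem summable_self (hx : B.WhittleFeasible x) (i : ι) (k : S i) : Summable (x i k) :=
  (hx.summable i k).of_nonneg_of_le (hx.nonneg i k) fun t =>
    le_mul_of_one_le_left (hx.nonneg i k t) (by exact_mod_cast t.pos)

theorem summable_mul_f (hx : B.WhittleFeasible x) (i : ι) (k : S i) :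
    Summable fun t => x i k t * B.f i k t :=
  (hx.summable_self i k).of_nonneg_of_le
    (fun t => mul_nonneg (hx.nonneg i k t) (B.f_nonneg i k t))
    fun t => mul_le_of_le_one_right (hx.nonneg i k t) (B.f_le_one i k t)

theorem sum_escapeRate_mul_generator (hx : B.WhittleFeasible x) (i : ι) (g : S i → ℝ) :
    ∑ k, B.escapeRate x i k * B.generator i g k = 0 := by
  refine sum_mul_generator_eq_zero (fun k => ?_) g
  have hrate : ∀ j l m, ∑' t, x i j t * B.q i l m * B.f i j t = B.escapeRate x i j * B.q i l m :=
    fun j l m => by simp only [escapeRate, mul_right_comm _ (B.q i l m), tsum_mul_right]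
  simpa only [hrate] using hx.balance i k

theorem tsum_reward_le (hx : B.WhittleFeasible x) (hD : B.BalanceFeasible D) (i : ι) (k : S i) :
    ∑' t, B.r i k * x i k t ≤ D.lam * ∑' t, x i k t + D.h i * ∑' t : ℕ+, (t : ℝ) * x i k t
      - B.escapeRate x i k * B.deltaP D i k := by
  have hcost := (((hx.summable_self i k).hasSum.mul_left D.lam).add
    ((hx.summable i k).hasSum.mul_left (D.h i))).sub
    ((hx.summable_mul_f i k).hasSum.mul_right (B.deltaP D i k))
  refine hasSum_le (fun t => ?_) ((hx.summable_self i k).mul_left (B.r i k)).hasSum hcost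
  linarith [mul_le_mul_of_nonneg_right (hD.dual_all i k t) (hx.nonneg i k t)]

theorem objective_le (hx : B.WhittleFeasible x) (hD : B.BalanceFeasible D) :
    B.whittleObjective x ≤ D.lam + ∑ i, D.h i := by
  have hstationary : ∀ i, ∑ k, B.escapeRate x i k * B.deltaP D i k = 0 := fun i => by
    simp only [deltaP_eq_generator, hx.sum_escapeRate_mul_generator]
  calc B.whittleObjective x
      ≤ ∑ i, ∑ k, (D.lam * ∑' t, x i k t + D.h i * ∑' t : ℕ+, (t : ℝ) * x i k t
        - B.escapeRate x i k * B.deltaP D i k) :=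
        Finset.sum_le_sum fun i _ => Finset.sum_le_sum fun k _ => hx.tsum_reward_le hD i k
    _ = D.lam * ∑ i, ∑ k, ∑' t, x i k t
        + ∑ i, D.h i * ∑ k, ∑' t : ℕ+, (t : ℝ) * x i k t := by
        simp only [Finset.sum_sub_distrib, Finset.sum_add_distrib, hstationary, Finset.mul_sum,
          sub_zero]
    _ ≤ D.lam * 1 + ∑ i, D.h i * 1 :=
        add_le_add (mul_le_mul_of_nonneg_left hx.plays_le hD.lam_nonneg)
          (Finset.sum_le_sum fun i _ => mul_le_mul_of_nonneg_left (hx.time_le i) (hD.h_nonneg i))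
    _ = D.lam + ∑ i, D.h i := by simp only [mul_one]

end WhittleFeasible

theorem BalanceFeasible.OPT_le (hD : B.BalanceFeasible D) : B.OPT ≤ D.lam + ∑ i, D.h i := by
  refine B.OPT_isLUB.2 ?_
  rintro _ ⟨x, hx, rfl⟩
  exact hx.objective_le hD

/-! ### Existence of a BalancedIndex policy -/

theorem generator_neg_pow_neg {ε : ℝ} (hε : 0 < ε) (hε' : ε < 1) {d : S i → ℕ} {l : S i}
    (hl : ε < B.q i k l) (hd : d l < d k) : B.generator i (fun j => -ε ^ d j) k < 0 := by
  have hmem : l ∈ Finset.univ.erase k :=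
    Finset.mem_erase.2 ⟨fun h => hd.ne (congrArg d h), Finset.mem_univ l⟩
  have hsplit : B.generator i (fun j => -ε ^ d j) k
      = (∑ j ∈ Finset.univ.erase k, B.q i k j) * ε ^ d k
        - ∑ j ∈ Finset.univ.erase k, B.q i k j * ε ^ d j := by
    rw [generator_apply, Finset.sum_mul, ← Finset.sum_sub_distrib]
    exact Finset.sum_congr rfl fun j _ => by ring
  have hloss : (∑ j ∈ Finset.univ.erase k, B.q i k j) * ε ^ d k ≤ ε ^ d k :=
    mul_le_of_le_one_left (by positivity) (B.q_sum_le_one i k)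
  have hgain : ε ^ d k < ∑ j ∈ Finset.univ.erase k, B.q i k j * ε ^ d j := calc
    ε ^ d k ≤ ε ^ (d l + 1) := pow_le_pow_of_le_one hε.le hε'.le hd
    _ = ε * ε ^ d l := pow_succ' ε (d l)
    _ < B.q i k l * ε ^ d l := mul_lt_mul_of_pos_right hl (by positivity)
    _ ≤ _ := Finset.single_le_sum (f := fun j => B.q i k j * ε ^ d j)
      (fun j _ => mul_nonneg (B.q_nonneg i k j) (by positivity)) hmem
  linarith

theorem exists_generator_neg (B : MonotoneBandit ι S) (i : ι) (k : S i) :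
    ∃ g : S i → ℝ, ∀ j ≠ k, B.generator i g j < 0 := by
  obtain ⟨d, hd⟩ := exists_rank_of_reflTransGen fun j => B.connected i j k
  obtain ⟨ε, hε, hε', hεq⟩ := exists_pos_lt_of_finite fun e : S i × S i => B.q i e.1 e.2
  refine ⟨fun j => -ε ^ d j, fun j hj => ?_⟩
  obtain ⟨l, hq, hdl⟩ := hd j hj
  exact generator_neg_pow_neg hε hε' (hεq (j, l) hq) hdl

theorem BalanceFeasible.reward_eq_of_tight (hD : B.BalanceFeasible D) {t : ℕ+}
    (ht : t ∈ B.tightTimes D i k) (hf : B.f i k t = 0) :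
    B.f i k 1 = 0 ∧ B.r i k = D.lam + D.h i := by
  have hf₁ : B.f i k 1 = 0 := le_antisymm (hf ▸ B.f_monotone i k one_le) (B.f_nonneg i k 1)
  have htight := ht.2
  have hdual := hD.dual i k 1 (B.one_mem_W i k)
  have hle : 1 * D.h i ≤ t * D.h i :=
    mul_le_mul_of_nonneg_right (by exact_mod_cast t.pos) (hD.h_nonneg i)
  rw [hf, zero_mul, add_zero] at htight
  rw [hf₁, zero_mul, add_zero, PNat.one_coe, Nat.cast_one] at hdual
  exact ⟨hf₁, by linarith⟩

/-- Adding to the potential of the arm a small multiple of a function on which the generator is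
negative in all states but `k` makes every tight constraint slack. -/
theorem BalanceFeasible.exists_slack (hD : B.BalanceFeasible D)
    (hk : ¬ (B.tightTimes D i k).Nonempty)
    (habs : ∀ j, B.f i j 1 = 0 → B.r i j ≠ D.lam + D.h i) :
    ∃ p : S i → ℝ, ∀ j, ∀ t ∈ B.W i j,
      B.r i j + B.f i j t * B.generator i p j < D.lam + (t : ℝ) * D.h i := by
  obtain ⟨g, hg⟩ := B.exists_generator_neg i k
  have hev : ∀ᶠ η : ℝ in 𝓝[>] 0, ∀ j, ∀ t ∈ B.W i j,
      B.r i j + B.f i j t * (B.deltaP D i j + η * B.generator i g j)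
        < D.lam + (t : ℝ) * D.h i := by
    refine eventually_all.2 fun j => (Finset.eventually_all _).2 fun t ht => ?_
    rcases (hD.dual i j t ht).lt_or_eq with hslack | htight
    · refine mem_nhdsWithin_of_mem_nhds (ContinuousAt.eventually_lt (by fun_prop)
        continuousAt_const ?_)
      simpa using hslack
    · have hmem : t ∈ B.tightTimes D i j := ⟨ht, htight.symm⟩
      have hjk : j ≠ k := by
        rintro rfl
        exact hk ⟨t, hmem⟩
      have hf : 0 < B.f i j t := (B.f_nonneg i j t).lt_of_ne' fun h =>
        habs j (hD.reward_eq_of_tight hmem h).1 (hD.reward_eq_of_tight hmem h).2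
      filter_upwards [self_mem_nhdsWithin] with η hη
      have hdecrease : B.f i j t * (η * B.generator i g j) < 0 :=
        mul_neg_of_pos_of_neg hf (mul_neg_of_pos_of_neg hη (hg j hjk))
      linarith
  obtain ⟨η, hη⟩ := hev.exists
  refine ⟨D.p i + η • g, fun j t ht => ?_⟩
  rw [map_add, map_smul, Pi.add_apply, Pi.smul_apply, smul_eq_mul, ← deltaP_eq_generator]
  exact hη j t ht

/-- A perturbation of `D` that lowers `λ` by `ε` at the expense of arm `i`, whose constraints must
have slack for the potential `p`: the other arms are compensated for the smaller `λ` by raising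
their `h l` by `ε`, and `h i` keeps the balance `λ = ∑ h`. -/
def perturb (D : BalanceVars ι S) (i : ι) (p : S i → ℝ) (ε : ℝ) : BalanceVars ι S where
  lam := D.lam - ε
  h := Function.update (fun l => D.h l + ε) i (D.h i - Fintype.card ι * ε)
  p := Function.update D.p i p

theorem BalanceFeasible.sum_perturb_h (hD : B.BalanceFeasible D) (i : ι) (p : S i → ℝ) (ε : ℝ) :
    ∑ l, (perturb D i p ε).h l = D.lam - ε := by
  have hall : ∑ l, (D.h l + ε) = D.lam + Fintype.card ι * ε := by
    simp [Finset.sum_add_distrib, hD.balance]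
  rw [← Finset.sum_erase_add _ _ (Finset.mem_univ i)] at hall
  have hother : ∑ l ∈ Finset.univ.erase i, (perturb D i p ε).h l
      = ∑ l ∈ Finset.univ.erase i, (D.h l + ε) :=
    Finset.sum_congr rfl fun l hl => by simp [perturb, Finset.ne_of_mem_erase hl]
  have hself : (perturb D i p ε).h i = D.h i - Fintype.card ι * ε := by simp [perturb]
  rw [← Finset.sum_erase_add _ _ (Finset.mem_univ i), hother, hself]
  linarith

theorem balanceFeasible_perturb (hD : B.BalanceFeasible D) {p : S i → ℝ} {ε : ℝ} (hε : 0 ≤ ε)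
    (hi : 0 ≤ D.h i - Fintype.card ι * ε)
    (hp : ∀ j, ∀ t ∈ B.W i j, B.r i j + B.f i j t * B.generator i p j
      ≤ D.lam - ε + (t : ℝ) * (D.h i - Fintype.card ι * ε)) :
    B.BalanceFeasible (perturb D i p ε) := by
  have hh : ∀ l, 0 ≤ (perturb D i p ε).h l := fun l => by
    rcases eq_or_ne l i with rfl | hl
    · simpa [perturb] using hi
    · simpa [perturb, hl] using add_nonneg (hD.h_nonneg l) hε
  have hsum := hD.sum_perturb_h i p ε
  refine ⟨fun l k t ht => ?_, hsum.symm, ?_, hh⟩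
  · rw [deltaP_eq_generator]
    rcases eq_or_ne l i with rfl | hl
    · simpa [perturb] using hp k t ht
    · simp only [perturb, Function.update_of_ne hl, ← deltaP_eq_generator]
      have hcomp : 1 * ε ≤ t * ε := mul_le_mul_of_nonneg_right (by exact_mod_cast t.pos) hε
      linarith [hD.dual l k t ht]
  · exact (Finset.sum_nonneg fun l _ => hh l).trans_eq hsum

theorem BalanceFeasible.exists_lt_of_slack (hD : B.BalanceFeasible D) (hi : 0 < D.h i)
    {p : S i → ℝ} (hp : ∀ j, ∀ t ∈ B.W i j,
      B.r i j + B.f i j t * B.generator i p j < D.lam + (t : ℝ) * D.h i) :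
    ∃ D', B.BalanceFeasible D' ∧ D'.lam + ∑ l, D'.h l < D.lam + ∑ l, D.h l := by
  have hdual : ∀ᶠ ε : ℝ in 𝓝[>] 0, ∀ j, ∀ t ∈ B.W i j,
      B.r i j + B.f i j t * B.generator i p j
        < D.lam - ε + (t : ℝ) * (D.h i - Fintype.card ι * ε) := by
    refine eventually_all.2 fun j => (Finset.eventually_all _).2 fun t ht => ?_
    refine mem_nhdsWithin_of_mem_nhds (ContinuousAt.eventually_lt continuousAt_const
      (by fun_prop) ?_)
    simpa using hp j t ht
  have hpos : ∀ᶠ ε : ℝ in 𝓝[>] 0, 0 < D.h i - Fintype.card ι * ε := by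
    refine mem_nhdsWithin_of_mem_nhds (ContinuousAt.eventually_lt continuousAt_const
      (by fun_prop) ?_)
    simpa using hi
  obtain ⟨ε, ⟨hdualε, hposε⟩, hε⟩ := ((hdual.and hpos).and self_mem_nhdsWithin).exists
  have hε₀ : 0 < ε := hε
  refine ⟨_, balanceFeasible_perturb hD hε₀.le hposε.le fun j t ht => (hdualε j t ht).le, ?_⟩
  rw [hD.sum_perturb_h, ← hD.balance]
  exact add_lt_add (sub_lt_self _ hε₀) (sub_lt_self _ hε₀)

theorem BalanceOptimal.exists_absorbing (hD : B.BalanceOptimal D) (h : ¬ B.AllTight D) :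
    ∃ i, 0 < D.h i ∧ ∃ j, B.f i j 1 = 0 ∧ B.r i j = D.lam + D.h i := by
  simp only [AllTight, not_forall] at h
  obtain ⟨i, hi, k, hk⟩ := h
  refine ⟨i, hi, ?_⟩
  by_contra! habs
  obtain ⟨p, hp⟩ := hD.1.exists_slack hk habs
  obtain ⟨D', hD', hlt⟩ := hD.1.exists_lt_of_slack hi hp
  exact (hD.2 D' hD').not_gt hlt

theorem exists_indexAction (B : MonotoneBandit ι S) (D : BalanceVars ι S) (past : History S)
    (c : Config S) : ∃ a, B.IndexAction D past c a := by
  unfold IndexAction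
  by_cases hcont : ∃ i, lastAction past = some i ∧ B.Good D c i
  · obtain ⟨i, hi⟩ := hcont
    exact ⟨some i, Or.inl ⟨i, hi.1, hi.2, rfl⟩⟩
  by_cases hgood : ∃ i, B.Good D c i
  · exact ⟨some hgood.choose, Or.inr (Or.inl ⟨hcont, _, hgood.choose_spec, rfl⟩)⟩
  by_cases hready : ∃ i, B.Ready D c i
  · exact ⟨some hready.choose, Or.inr (Or.inr (Or.inl ⟨hgood, _, hready.choose_spec, rfl⟩))⟩
  · exact ⟨none, Or.inr (Or.inr (Or.inr ⟨hgood, hready, rfl⟩))⟩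

theorem BalanceOptimal.exists_isBalancedIndex [∀ i, Nonempty (S i)] (hD : B.BalanceOptimal D) :
    ∃ (s : ∀ i, S i) (π : Policy S), B.IsBalancedIndex D s π := by
  let s₀ : ∀ i, S i := fun i => Classical.arbitrary (S i)
  by_cases h : B.AllTight D
  · choose a ha using B.exists_indexAction D
    refine ⟨s₀, fun past c => PMF.pure (a past c), Or.inl ⟨h, fun past c b hb => ?_⟩⟩
    rw [PMF.support_pure, Set.mem_singleton_iff] at hb
    exact hb ▸ ha past c
  · obtain ⟨i, hi, j, hf, hr⟩ := hD.exists_absorbing h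
    refine ⟨Function.update s₀ i j, fun _ _ => PMF.pure (some i), Or.inr ⟨h, i, hi, ?_, ?_,
      fun _ _ => rfl⟩⟩
    · rwa [Function.update_self]
    · rwa [Function.update_self]

/-! ### The drift of a potential -/

variable {π : Policy S} {c c₀ : Config S} {s : ∀ i, S i} {ω : History S × Config S}
  {Φ : History S × Config S → ℝ} {κ C : ℝ}

theorem finite_support_step (B : MonotoneBandit ι S) (c : Config S) (a : Option ι) :
    (B.step c a).support.Finite := by
  cases a with
  | none => simp [step]
  | some i => exact finite_support_map (Set.toFinite _) _

theorem finite_support_law (B : MonotoneBandit ι S) (π : Policy S) (c₀ : Config S) (T : ℕ) :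
    (B.law π c₀ T).support.Finite := by
  induction T with
  | zero => simp [law]
  | succ T ih =>
    exact finite_support_bind ih fun ω => finite_support_bind (Set.toFinite _) fun a =>
      finite_support_map (B.finite_support_step ω.2 a) _

theorem mem_support_step_some {c' : Config S} (h : c' ∈ (B.step c (some i)).support) :
    ∃ j ∈ (B.nextState i (c i).1 (c i).2).support, c' = Function.update (wait c) i (j, 1) := by
  rw [step, PMF.mem_support_map_iff] at h
  obtain ⟨j, hj, rfl⟩ := h
  exact ⟨j, hj, rfl⟩

theorem law_invariant {Inv : History S × Config S → Prop} (hinit : Inv ([], c₀))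
    (hstep : ∀ ω, Inv ω → ∀ a ∈ (π ω.1 ω.2).support, ∀ c' ∈ (B.step ω.2 a).support,
      Inv ((ω.2, a) :: ω.1, c')) (T : ℕ) : ∀ ω ∈ (B.law π c₀ T).support, Inv ω := by
  induction T with
  | zero =>
    intro ω hω
    rw [law, PMF.support_pure, Set.mem_singleton_iff] at hω
    exact hω ▸ hinit
  | succ T ih =>
    intro ω' hω'
    simp only [law, PMF.mem_support_bind_iff, PMF.mem_support_map_iff] at hω'
    obtain ⟨ω, hω, a, ha, c', hc', rfl⟩ := hω'
    exact hstep ω (ih ω hω) a ha c' hc'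

theorem expStepReward_eq (B : MonotoneBandit ι S) (π : Policy S) (c₀ : Config S) (T : ℕ) :
    B.expStepReward π c₀ T
      = expectation (B.law π c₀ T) fun ω => expectation (π ω.1 ω.2) (B.reward ω.2) := by
  simp only [expStepReward, expectation, tsum_fintype]

theorem expectation_law_succ (B : MonotoneBandit ι S) (π : Policy S) (c₀ : Config S) (T : ℕ)
    (Φ : History S × Config S → ℝ) :
    expectation (B.law π c₀ (T + 1)) Φ = expectation (B.law π c₀ T) fun ω =>
      expectation (π ω.1 ω.2) fun a =>
        expectation (B.step ω.2 a) fun c' => Φ ((ω.2, a) :: ω.1, c') := by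
  have hstep : ∀ (ω : History S × Config S) a,
      ((B.step ω.2 a).map fun c' => ((ω.2, a) :: ω.1, c')).support.Finite := fun ω a =>
    finite_support_map (B.finite_support_step ω.2 a) _
  rw [law, expectation_bind (B.finite_support_law π c₀ T) fun ω =>
    finite_support_bind (Set.toFinite _) (hstep ω)]
  simp only [expectation_bind (Set.toFinite _) (hstep _),
    expectation_map (B.finite_support_step _ _)]

/-- The expected value of the reward plus the change of the potential `Φ` in a step in which
action `a` is taken after `ω`. -/
def drift (B : MonotoneBandit ι S) (Φ : History S × Config S → ℝ) (ω : History S × Config S)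
    (a : Option ι) : ℝ :=
  B.reward ω.2 a + expectation (B.step ω.2 a) (fun c' => Φ ((ω.2, a) :: ω.1, c')) - Φ ω

theorem expectation_drift (B : MonotoneBandit ι S) (π : Policy S) (c₀ : Config S)
    (Φ : History S × Config S → ℝ) (T : ℕ) :
    expectation (B.law π c₀ T) (fun ω => expectation (π ω.1 ω.2) (B.drift Φ ω))
      = B.expStepReward π c₀ T + expectation (B.law π c₀ (T + 1)) Φ
        - expectation (B.law π c₀ T) Φ := by
  have hlaw := B.finite_support_law π c₀ T
  have hπ : ∀ ω : History S × Config S, (π ω.1 ω.2).support.Finite := fun ω => Set.toFinite _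
  unfold drift
  simp only [expectation_sub (hπ _), expectation_add (hπ _), expectation_const]
  rw [expectation_sub hlaw, expectation_add hlaw, ← expStepReward_eq, ← expectation_law_succ]

theorem sum_expStepReward_add_expectation (B : MonotoneBandit ι S) (π : Policy S)
    (c₀ : Config S) (Φ : History S × Config S → ℝ) (T : ℕ) :
    ∑ u ∈ Finset.range T, B.expStepReward π c₀ u + expectation (B.law π c₀ T) Φ
      = Φ ([], c₀) + ∑ u ∈ Finset.range T,
        expectation (B.law π c₀ u) fun ω => expectation (π ω.1 ω.2) (B.drift Φ ω) := by
  induction T with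
  | zero => simp [law, expectation_pure]
  | succ T ih =>
    rw [Finset.sum_range_succ, Finset.sum_range_succ, expectation_drift]
    linarith

/-! ### Long-term averages -/

theorem reward_nonneg (B : MonotoneBandit ι S) (c : Config S) (a : Option ι) :
    0 ≤ B.reward c a := by
  cases a with
  | none => exact le_rfl
  | some i => exact B.r_nonneg i _

theorem exists_reward_le (B : MonotoneBandit ι S) : ∃ R, ∀ c a, B.reward c a ≤ R := by
  obtain ⟨R, hR⟩ := Finite.exists_le fun x : Option (Σ i, S i) => x.elim 0 fun x => B.r x.1 x.2
  refine ⟨R, fun c a => ?_⟩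
  cases a with
  | none => exact hR none
  | some i => exact hR (some ⟨i, (c i).1⟩)

theorem expStepReward_nonneg (B : MonotoneBandit ι S) (π : Policy S) (c₀ : Config S) (T : ℕ) :
    0 ≤ B.expStepReward π c₀ T := by
  rw [expStepReward_eq]
  exact le_expectation (B.finite_support_law π c₀ T) fun ω _ =>
    le_expectation (Set.toFinite _) fun a _ => B.reward_nonneg ω.2 a

theorem isBoundedUnder_ge_avgReward (B : MonotoneBandit ι S) (π : Policy S) (s : ∀ i, S i) :
    IsBoundedUnder (· ≥ ·) atTop (B.avgReward π s) :=
  isBoundedUnder_of ⟨0, fun T =>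
    div_nonneg (Finset.sum_nonneg fun u _ => B.expStepReward_nonneg π (start s) u)
      (Nat.cast_nonneg T)⟩

theorem isBoundedUnder_le_avgReward (B : MonotoneBandit ι S) (π : Policy S) (s : ∀ i, S i) :
    IsBoundedUnder (· ≤ ·) atTop (B.avgReward π s) := by
  obtain ⟨R, hR⟩ := B.exists_reward_le
  have hR₀ : 0 ≤ R := hR (start s) none
  have hstep : ∀ u, B.expStepReward π (start s) u ≤ R := fun u => by
    rw [expStepReward_eq]
    exact expectation_le (B.finite_support_law π (start s) u) fun ω _ =>
      expectation_le (Set.toFinite _) fun a _ => hR ω.2 a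
  refine isBoundedUnder_of ⟨R, fun T => div_le_of_le_mul₀ (Nat.cast_nonneg T) hR₀ ?_⟩
  calc ∑ u ∈ Finset.range T, B.expStepReward π (start s) u
      ≤ ∑ _u ∈ Finset.range T, R := Finset.sum_le_sum fun u _ => hstep u
    _ = R * T := by rw [Finset.sum_const, Finset.card_range, nsmul_eq_mul, mul_comm]

theorem tendsto_add_const_div (κ C : ℝ) :
    Tendsto (fun T : ℕ => κ + C / T) atTop (𝓝 κ) := by
  simpa using (tendsto_const_div_atTop_nhds_zero_nat C).const_add κ

theorem le_liminf_avgReward_of_drift {Inv : History S × Config S → Prop}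
    (hinit : Inv ([], start s))
    (hstep : ∀ ω, Inv ω → ∀ a ∈ (π ω.1 ω.2).support, ∀ c' ∈ (B.step ω.2 a).support,
      Inv ((ω.2, a) :: ω.1, c'))
    (hΦ : ∀ ω, Φ ω ≤ C) (hdrift : ∀ ω, Inv ω → ∀ a ∈ (π ω.1 ω.2).support, κ ≤ B.drift Φ ω a) :
    κ ≤ liminf (B.avgReward π s) atTop := by
  have hlim := tendsto_add_const_div κ (Φ ([], start s) - C)
  rw [← hlim.liminf_eq]
  refine liminf_le_liminf ?_ hlim.isBoundedUnder_ge
    (B.isBoundedUnder_le_avgReward π s).isCoboundedUnder_ge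
  filter_upwards [eventually_gt_atTop 0] with T hT
  have hT₀ : (0 : ℝ) < T := by exact_mod_cast hT
  have hdynkin := B.sum_expStepReward_add_expectation π (start s) Φ T
  have hfinal := expectation_le (B.finite_support_law π (start s) T) fun ω _ => hΦ ω
  have hstep_ge : ∀ u ∈ Finset.range T, κ ≤ expectation (B.law π (start s) u) fun ω =>
      expectation (π ω.1 ω.2) (B.drift Φ ω) := fun u _ =>
    le_expectation (B.finite_support_law π (start s) u) fun ω hω =>
      le_expectation (Set.toFinite _) (hdrift ω (law_invariant hinit hstep u ω hω))
  have hsteps := Finset.card_nsmul_le_sum _ _ _ hstep_ge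
  rw [Finset.card_range, nsmul_eq_mul] at hsteps
  rw [avgReward, le_div_iff₀ hT₀, add_mul, div_mul_cancel₀ _ hT₀.ne']
  linarith

theorem limsup_avgReward_le_of_drift (hΦ : ∀ ω, C ≤ Φ ω) (hdrift : ∀ ω a, B.drift Φ ω a ≤ κ) :
    limsup (B.avgReward π s) atTop ≤ κ := by
  have hlim := tendsto_add_const_div κ (Φ ([], start s) - C)
  rw [← hlim.limsup_eq]
  refine limsup_le_limsup ?_ (B.isBoundedUnder_ge_avgReward π s).isCoboundedUnder_le
    hlim.isBoundedUnder_le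
  filter_upwards [eventually_gt_atTop 0] with T hT
  have hT₀ : (0 : ℝ) < T := by exact_mod_cast hT
  have hdynkin := B.sum_expStepReward_add_expectation π (start s) Φ T
  have hfinal := le_expectation (B.finite_support_law π (start s) T) fun ω _ => hΦ ω
  have hstep_le : ∀ u ∈ Finset.range T, expectation (B.law π (start s) u) (fun ω =>
      expectation (π ω.1 ω.2) (B.drift Φ ω)) ≤ κ := fun u _ =>
    expectation_le (B.finite_support_law π (start s) u) fun ω _ =>
      expectation_le (Set.toFinite _) fun a _ => hdrift ω a
  have hsteps := Finset.sum_le_card_nsmul _ _ _ hstep_le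
  rw [Finset.card_range, nsmul_eq_mul] at hsteps
  rw [avgReward, div_le_iff₀ hT₀, add_mul, div_mul_cancel₀ _ hT₀.ne']
  linarith

/-! ### Potentials that are additive over the arms -/

theorem expectation_nextState (B : MonotoneBandit ι S) (i : ι) (k : S i) (t : ℕ+) (g : S i → ℝ) :
    expectation (B.nextState i k t) g = g k + B.f i k t * B.generator i g k := by
  have hfinite : expectation (B.nextState i k t) g = ∑ j, B.transProb i k t j * g j := by
    rw [expectation, tsum_fintype]
    refine Finset.sum_congr rfl fun j _ => ?_
    rw [nextState, PMF.ofFintype_apply, ENNReal.toReal_ofReal (B.transProb_nonneg i k t j)]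
  have hcenter : ∑ j, B.transProb i k t j * g j
      = g k + ∑ j, B.transProb i k t j * (g j - g k) := by
    simp only [mul_sub, Finset.sum_sub_distrib, ← Finset.sum_mul, transProb_sum]
    ring
  rw [hfinite, hcenter, ← Finset.sum_erase_add _ _ (Finset.mem_univ k), sub_self, mul_zero,
    add_zero, generator_apply, Finset.mul_sum]
  congr 1
  refine Finset.sum_congr rfl fun j hj => ?_
  rw [transProb, if_neg (Finset.ne_of_mem_erase hj), mul_assoc]

/-- The potential `∑ l, φ a l (k_l, y_l)`, where `a` is the action of the most recent step, `k_l`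
the state of arm `l` and `y_l` its clock. -/
def additivePotential (φ : Option ι → ∀ l, S l × ℕ+ → ℝ) (ω : History S × Config S) : ℝ :=
  ∑ l, φ (lastAction ω.1) l (ω.2 l)

theorem drift_additivePotential_none (B : MonotoneBandit ι S)
    (φ : Option ι → ∀ l, S l × ℕ+ → ℝ) (ω : History S × Config S) :
    B.drift (additivePotential φ) ω none
      = ∑ l, (φ none l (wait ω.2 l) - φ (lastAction ω.1) l (ω.2 l)) := by
  simp only [drift, step, expectation_pure, additivePotential, lastAction, reward, zero_add,
    Finset.sum_sub_distrib]

theorem drift_additivePotential_some (B : MonotoneBandit ι S)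
    (φ : Option ι → ∀ l, S l × ℕ+ → ℝ) (ω : History S × Config S) (i : ι) :
    B.drift (additivePotential φ) ω (some i)
      = B.r i (ω.2 i).1 + φ (some i) i ((ω.2 i).1, 1)
        + B.f i (ω.2 i).1 (ω.2 i).2
          * B.generator i (fun j => φ (some i) i (j, 1)) (ω.2 i).1
        - φ (lastAction ω.1) i (ω.2 i)
        + ∑ l ∈ Finset.univ.erase i,
          (φ (some i) l (wait ω.2 l) - φ (lastAction ω.1) l (ω.2 l)) := by
  have hupdate : ∀ j : S i, ∑ l, φ (some i) l (Function.update (wait ω.2) i (j, 1) l)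
      = φ (some i) i (j, 1) + ∑ l ∈ Finset.univ.erase i, φ (some i) l (wait ω.2 l) := fun j => by
    rw [← Finset.add_sum_erase _ _ (Finset.mem_univ i), Function.update_self]
    congr 1
    exact Finset.sum_congr rfl fun l hl => by
      rw [Function.update_of_ne (Finset.ne_of_mem_erase hl)]
  have hlast : ∀ c, lastAction ((c, some i) :: ω.1) = some i := fun _ => rfl
  simp only [drift, step, expectation_map (Set.toFinite _), additivePotential, hlast,
    reward, hupdate, expectation_nextState, generator_add_const, Finset.sum_sub_distrib]
  rw [← Finset.add_sum_erase _ (fun l => φ (lastAction ω.1) l (ω.2 l)) (Finset.mem_univ i)]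
  ring

/-! ### Upper bound for all policies -/

/-- The dual potential, in which arm `l` accrues `h l` per step of waiting. -/
def dualPotential (D : BalanceVars ι S) : History S × Config S → ℝ :=
  additivePotential fun _ l x => D.p l x.1 + D.h l * (x.2 : ℝ)

theorem BalanceFeasible.drift_dualPotential_le (hD : B.BalanceFeasible D)
    (ω : History S × Config S) (a : Option ι) :
    B.drift (dualPotential D) ω a ≤ D.lam + ∑ l, D.h l := by
  have hwait : ∀ l, D.p l (wait ω.2 l).1 + D.h l * ((wait ω.2 l).2 : ℝ)
      - (D.p l (ω.2 l).1 + D.h l * ((ω.2 l).2 : ℝ)) = D.h l := fun l => by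
    simp only [wait, PNat.add_coe, PNat.one_coe, Nat.cast_add, Nat.cast_one]
    ring
  cases a with
  | none =>
    rw [dualPotential, drift_additivePotential_none, Finset.sum_congr rfl fun l _ => hwait l]
    exact le_add_of_nonneg_left hD.lam_nonneg
  | some i =>
    rw [dualPotential, drift_additivePotential_some, Finset.sum_congr rfl fun l _ => hwait l]
    simp only [generator_add_const, ← deltaP_eq_generator, PNat.one_coe, Nat.cast_one]
    rw [← Finset.add_sum_erase _ _ (Finset.mem_univ i)]
    linarith [hD.dual_all i (ω.2 i).1 (ω.2 i).2]

theorem BalanceFeasible.limsup_avgReward_le (hD : B.BalanceFeasible D) (π : Policy S)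
    (s : ∀ i, S i) : limsup (B.avgReward π s) atTop ≤ D.lam + ∑ l, D.h l := by
  choose m hm using fun l => Finite.exists_ge (D.p l)
  refine limsup_avgReward_le_of_drift (C := ∑ l, m l) (fun ω => Finset.sum_le_sum fun l _ => ?_)
    hD.drift_dualPotential_le
  exact (hm l _).trans
    (le_add_of_nonneg_right (mul_nonneg (hD.h_nonneg l) (Nat.cast_nonneg _)))

/-! ### Lower bound for BalancedIndex policies -/

variable {K : ℝ}

/-- The smallest tight time `t^i_k`.  It is an arbitrary number if no constraint is tight. -/
def tightTime (B : MonotoneBandit ι S) (D : BalanceVars ι S) (i : ι) (k : S i) : ℕ+ :=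
  Classical.epsilon (IsLeast (B.tightTimes D i k))

theorem isLeast_tightTime (h : (B.tightTimes D i k).Nonempty) :
    IsLeast (B.tightTimes D i k) (B.tightTime D i k) := by
  obtain ⟨t, ht, hmin⟩ := WellFounded.has_min wellFounded_lt _ h
  exact Classical.epsilon_spec (p := IsLeast (B.tightTimes D i k))
    ⟨t, ht, fun u hu => not_lt.1 (hmin u hu)⟩

theorem BalanceFeasible.eq_one_of_mem_tightTimes (hD : B.BalanceFeasible D) (hi : 0 < D.h i)
    (hk : B.deltaP D i k < 0) {t : ℕ+} (ht : t ∈ B.tightTimes D i k) : t = 1 := by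
  have hdual := hD.dual i k 1 (B.one_mem_W i k)
  have hmono := mul_le_mul_of_nonpos_right (B.f_monotone i k (one_le (a := t))) hk.le
  have htight := ht.2
  rw [PNat.one_coe, Nat.cast_one] at hdual
  have hle : (t : ℝ) * D.h i ≤ 1 * D.h i := by linarith
  have hle' : (t : ℝ) ≤ 1 := le_of_mul_le_mul_right hle hi
  exact le_antisymm (by exact_mod_cast hle') one_le

/-- The contribution of arm `l` to the potential of the index rule, if the most recent action is
`a`: the arm accrues `h l` per step of waiting until its smallest tight time, and a retained arm in
a good state that was not just played is penalized by `K`. -/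
def armPotential (B : MonotoneBandit ι S) (D : BalanceVars ι S) (K : ℝ) (a : Option ι) (l : ι)
    (x : S l × ℕ+) : ℝ :=
  D.p l x.1 + D.h l * ((min x.2 (B.tightTime D l x.1) : ℕ+) : ℝ)
    - if (0 < D.h l ∧ B.deltaP D l x.1 < 0) ∧ a ≠ some l then K else 0

/-- The sum of the contributions `armPotential` of all arms, the potential with which the index rule
is analysed. -/
def indexPotential (B : MonotoneBandit ι S) (D : BalanceVars ι S) (K : ℝ) :
    History S × Config S → ℝ :=
  additivePotential (B.armPotential D K)

theorem armPotential_le (hK : 0 ≤ K) (hi : 0 ≤ D.h i) (a : Option ι) (x : S i × ℕ+) :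
    B.armPotential D K a i x ≤ D.p i x.1 + D.h i * (B.tightTime D i x.1 : ℝ) := by
  have hmin : ((min x.2 (B.tightTime D i x.1) : ℕ+) : ℝ) ≤ (B.tightTime D i x.1 : ℝ) := by
    exact_mod_cast min_le_right _ _
  have haccrued := mul_le_mul_of_nonneg_left hmin hi
  unfold armPotential
  split_ifs <;> linarith

theorem armPotential_le_armPotential_wait (hK : 0 ≤ K) (hi : 0 ≤ D.h i) {a : Option ι}
    (ha : B.Good D c i → a ≠ some i) (a' : Option ι) :
    B.armPotential D K a i (c i) ≤ B.armPotential D K a' i (wait c i) := by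
  have hmin : ((min (c i).2 (B.tightTime D i (c i).1) : ℕ+) : ℝ)
      ≤ ((min ((c i).2 + 1) (B.tightTime D i (c i).1) : ℕ+) : ℝ) := by
    exact_mod_cast min_le_min_right _ (PNat.lt_add_right _ 1).le
  have haccrued := mul_le_mul_of_nonneg_left hmin hi
  unfold armPotential wait
  dsimp only
  split_ifs with hold hnew hnew
  · linarith
  · linarith
  · exact absurd ⟨hnew.1, ha hnew.1⟩ hold
  · linarith

theorem armPotential_self_one (k : S i) :
    B.armPotential D K (some i) i (k, 1) = D.p i k + D.h i := by
  simp [armPotential]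

theorem BalanceFeasible.lam_le_drift_some (hD : B.BalanceFeasible D) (hK : 0 ≤ K)
    (hother : ∀ l ≠ i, B.Good D ω.2 l → lastAction ω.1 ≠ some l)
    (hplayed : D.lam + B.armPotential D K (lastAction ω.1) i (ω.2 i)
      ≤ B.r i (ω.2 i).1 + B.f i (ω.2 i).1 (ω.2 i).2 * B.deltaP D i (ω.2 i).1
        + D.p i (ω.2 i).1 + D.h i) :
    D.lam ≤ B.drift (B.indexPotential D K) ω (some i) := by
  have hwait : 0 ≤ ∑ l ∈ Finset.univ.erase i, (B.armPotential D K (some i) l (wait ω.2 l)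
      - B.armPotential D K (lastAction ω.1) l (ω.2 l)) :=
    Finset.sum_nonneg fun l hl => sub_nonneg.2 <| armPotential_le_armPotential_wait hK
      (hD.h_nonneg l) (hother l (Finset.ne_of_mem_erase hl)) (some i)
  rw [indexPotential, drift_additivePotential_some]
  simp only [armPotential_self_one, generator_add_const, ← deltaP_eq_generator]
  linarith

theorem BalanceFeasible.tightTime_eq_one (hD : B.BalanceFeasible D) (htight : B.AllTight D)
    (hgood : B.Good D c i) : B.tightTime D i (c i).1 = 1 :=
  hD.eq_one_of_mem_tightTimes hgood.1 hgood.2 (isLeast_tightTime (htight i hgood.1 _)).1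

theorem BalanceFeasible.lam_le_drift_of_continued (hD : B.BalanceFeasible D)
    (htight : B.AllTight D) (hK : 0 ≤ K) (hlast : lastAction ω.1 = some i) (hclock : (ω.2 i).2 = 1)
    (hgood : B.Good D ω.2 i) : D.lam ≤ B.drift (B.indexPotential D K) ω (some i) := by
  refine hD.lam_le_drift_some hK (fun l hl _ h => hl ?_) ?_
  · exact Option.some_injective _ (h.symm.trans hlast)
  · have hone := hD.tightTime_eq_one htight hgood
    have heq := (isLeast_tightTime (htight i hgood.1 (ω.2 i).1)).1.2
    rw [hone, PNat.one_coe, Nat.cast_one] at heq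
    simp only [armPotential, hlast, ne_eq, not_true, and_false, if_false, hone, hclock, min_self,
      PNat.one_coe, Nat.cast_one]
    linarith [hgood.1]

theorem BalanceFeasible.lam_le_drift_of_good (hD : B.BalanceFeasible D) (htight : B.AllTight D)
    (hK : 0 ≤ K) (hKΔ : D.lam - B.deltaP D i (ω.2 i).1 ≤ K)
    (hlast : ¬ ∃ l, lastAction ω.1 = some l ∧ B.Good D ω.2 l) (hgood : B.Good D ω.2 i) :
    D.lam ≤ B.drift (B.indexPotential D K) ω (some i) := by
  have hfresh : ∀ l, B.Good D ω.2 l → lastAction ω.1 ≠ some l := fun l hl h => hlast ⟨l, h, hl⟩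
  refine hD.lam_le_drift_some hK (fun l _ => hfresh l) ?_
  have hescape := mul_le_mul_of_nonpos_right (B.f_le_one i (ω.2 i).1 (ω.2 i).2) hgood.2.le
  rw [armPotential, if_pos ⟨hgood, hfresh i hgood⟩, hD.tightTime_eq_one htight hgood,
    min_eq_right one_le, PNat.one_coe, Nat.cast_one]
  linarith [B.r_nonneg i (ω.2 i).1]

theorem BalanceFeasible.lam_le_drift_of_ready (hD : B.BalanceFeasible D) (hK : 0 ≤ K)
    (hno : ¬ ∃ l, B.Good D ω.2 l) (hready : B.Ready D ω.2 i) :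
    D.lam ≤ B.drift (B.indexPotential D K) ω (some i) := by
  refine hD.lam_le_drift_some hK (fun l _ hl => absurd ⟨l, hl⟩ hno) ?_
  obtain ⟨-, hΔ, t, ht, hle⟩ := hready
  have htime : B.tightTime D i (ω.2 i).1 = t := (isLeast_tightTime ⟨t, ht.1⟩).unique ht
  have hescape := mul_le_mul_of_nonneg_right (B.f_monotone i (ω.2 i).1 hle) hΔ
  have heq := ht.1.2
  rw [armPotential, if_neg fun h => hΔ.not_gt h.1.2, htime, min_eq_right hle]
  linarith [hD.h_nonneg i]

theorem BalanceFeasible.lam_le_drift_none (hD : B.BalanceFeasible D) (htight : B.AllTight D)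
    (hno : ¬ ∃ l, B.Good D ω.2 l) (hnot : ¬ ∃ l, B.Ready D ω.2 l) :
    D.lam ≤ B.drift (B.indexPotential D K) ω none := by
  rw [indexPotential, drift_additivePotential_none, hD.balance]
  refine Finset.sum_le_sum fun l _ => ?_
  have hgood : ¬ (0 < D.h l ∧ B.deltaP D l (ω.2 l).1 < 0) := fun h => hno ⟨l, h⟩
  simp only [armPotential, wait, hgood, false_and, if_false]
  rcases (hD.h_nonneg l).eq_or_lt with hzero | hpos
  · simp [← hzero]
  · have hΔ : 0 ≤ B.deltaP D l (ω.2 l).1 := not_lt.1 fun h => hgood ⟨hpos, h⟩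
    have hlt : (ω.2 l).2 < B.tightTime D l (ω.2 l).1 := not_le.1 fun h =>
      hnot ⟨l, hpos, hΔ, _, isLeast_tightTime (htight l hpos _), h⟩
    rw [min_eq_left hlt.le, min_eq_left (PNat.add_one_le_iff.2 hlt), PNat.add_coe, PNat.one_coe,
      Nat.cast_add, Nat.cast_one]
    linarith

theorem BalanceFeasible.lam_le_drift_of_indexAction (hD : B.BalanceFeasible D)
    (htight : B.AllTight D) (hK : 0 ≤ K) (hKΔ : ∀ i k, D.lam - B.deltaP D i k ≤ K)
    (hclock : ∀ i, lastAction ω.1 = some i → (ω.2 i).2 = 1) {a : Option ι}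
    (ha : B.IndexAction D ω.1 ω.2 a) : D.lam ≤ B.drift (B.indexPotential D K) ω a := by
  rcases ha with ⟨i, hlast, hgood, rfl⟩ | ⟨hlast, i, hgood, rfl⟩ | ⟨hno, i, hready, rfl⟩ |
    ⟨hno, hnot, rfl⟩
  · exact hD.lam_le_drift_of_continued htight hK hlast (hclock i hlast) hgood
  · exact hD.lam_le_drift_of_good htight hK (hKΔ i _) hlast hgood
  · exact hD.lam_le_drift_of_ready hK hno hready
  · exact hD.lam_le_drift_none htight hno hnot

theorem BalanceFeasible.lam_le_liminf_of_indexAction (hD : B.BalanceFeasible D)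
    (htight : B.AllTight D) (s : ∀ i, S i)
    (hπ : ∀ past c, ∀ a ∈ (π past c).support, B.IndexAction D past c a) :
    D.lam ≤ liminf (B.avgReward π s) atTop := by
  obtain ⟨K, hKΔ⟩ := Finite.exists_le fun x : Σ i, S i => D.lam - B.deltaP D x.1 x.2
  have hK : 0 ≤ max K 0 := le_max_right K 0
  choose M hM using fun l => Finite.exists_le fun k => D.p l k + D.h l * (B.tightTime D l k : ℝ)
  refine le_liminf_avgReward_of_drift (Φ := B.indexPotential D (max K 0)) (C := ∑ l, M l)
    (Inv := fun ω => ∀ i, lastAction ω.1 = some i → (ω.2 i).2 = 1)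
    (fun i h => by simp [lastAction] at h) ?_ ?_ ?_
  · rintro ω - a - c' hc' i hi
    obtain rfl : a = some i := hi
    obtain ⟨j, -, rfl⟩ := mem_support_step_some hc'
    simp
  · exact fun ω => Finset.sum_le_sum fun l _ =>
      (armPotential_le hK (hD.h_nonneg l) _ _).trans (hM l _)
  · exact fun ω hω a ha => hD.lam_le_drift_of_indexAction htight hK
      (fun i k => (hKΔ ⟨i, k⟩).trans (le_max_left K 0)) hω (hπ ω.1 ω.2 a ha)

theorem eq_of_mem_support_nextState {j : S i} {t : ℕ+} (hf : B.f i k t = 0)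
    (hj : j ∈ (B.nextState i k t).support) : j = k := by
  by_contra hne
  rw [nextState, PMF.mem_support_ofFintype_iff] at hj
  simp [transProb, hne, hf] at hj

theorem reward_le_liminf_of_absorbing (hf : B.f i (s i) 1 = 0)
    (hπ : ∀ past c, π past c = PMF.pure (some i)) :
    B.r i (s i) ≤ liminf (B.avgReward π s) atTop := by
  have haction : ∀ ω : History S × Config S, ∀ a ∈ (π ω.1 ω.2).support, a = some i :=
    fun ω a ha => by rwa [hπ, PMF.support_pure, Set.mem_singleton_iff] at ha
  refine le_liminf_avgReward_of_drift (Φ := 0) (C := 0) (Inv := fun ω => ω.2 i = (s i, 1)) rfl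
    ?_ (fun _ => le_rfl) ?_
  · intro ω hω a ha c' hc'
    obtain rfl := haction ω a ha
    obtain ⟨j, hj, rfl⟩ := mem_support_step_some hc'
    rw [hω] at hj
    simp [eq_of_mem_support_nextState hf hj]
  · intro ω hω a ha
    obtain rfl := haction ω a ha
    simp [drift, expectation_const, reward, hω]

theorem BalanceFeasible.lam_le_liminf_avgReward (hD : B.BalanceFeasible D)
    (hπ : B.IsBalancedIndex D s π) : D.lam ≤ liminf (B.avgReward π s) atTop := by
  rcases hπ with ⟨htight, hπ⟩ | ⟨-, i, hi, hf, hr, hπ⟩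
  · exact hD.lam_le_liminf_of_indexAction htight s hπ
  · have hreward := reward_le_liminf_of_absorbing hf hπ
    linarith

end MonotoneBandit

end

theorem mainTheorem2 {ι : Type*} {S : ι → Type*} [Fintype ι] [DecidableEq ι]
    [∀ i, Fintype (S i)] [∀ i, DecidableEq (S i)] [∀ i, Nonempty (S i)]
    (B : MonotoneBandit ι S) :
    (∃ D : BalanceVars ι S, B.BalanceOptimal D) ∧
    ∀ D : BalanceVars ι S, B.BalanceOptimal D →
      (∃ (s : ∀ i, S i) (π : MonotoneBandit.Policy S), B.IsBalancedIndex D s π) ∧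
      ∀ (s : ∀ i, S i) (π : MonotoneBandit.Policy S), B.IsBalancedIndex D s π →
        B.OPT / 2 ≤ Filter.liminf (B.avgReward π s) Filter.atTop ∧
        ∀ (s' : ∀ i, S i) (π' : MonotoneBandit.Policy S),
          Filter.limsup (B.avgReward π' s') Filter.atTop
            ≤ 2 * Filter.liminf (B.avgReward π s) Filter.atTop := by
  refine ⟨B.exists_balanceOptimal, fun D hD => ⟨hD.exists_isBalancedIndex, fun s π hπ => ?_⟩⟩
  have hlow := hD.1.lam_le_liminf_avgReward hπ
  have hbalance := hD.1.balance
  refine ⟨?_, fun s' π' => ?_⟩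
  · have hOPT := hD.1.OPT_le
    linarith
  · have hhigh := hD.1.limsup_avgReward_le π' s'
    linarith
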